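/- Consider the types generated by $T ::= \mathcal U \mid \mathsf{Unit} \mid T\times T \mid \mathsf{Set}(T)$. Over a set of Ur-elements (the interpretation of $\mathcal U$), $\mathsf{Unit}$ is interpreted as a one-element set, products as Cartesian products, and $\mathsf{Set}(T)$ as the set of all (finite or infinite) sets of objects of type $T$. Well-typed terms over typed variables are given by $t,u ::= x \mid () \mid \langle t,u\rangle \mid \pi_1(t)\mid \pi_2(t)$, and $\Delta_0$ formulas by $$\varphi,\psi ::= t=_{\mathcal U}u \mid t\neq_{\mathcal U}u \mid \top\mid\bot\mid \varphi\vee\psi\mid\varphi\wedge\psi\mid \forall x\in_T t\;\varphi\mid \exists x\in_T t\;\varphi ,$$ where $t,u$ have type $\mathcal U$ in (in)equalities, and the bound $t$ of a quantifier $\forall x\in_T t$ or $\exists x\in_T t$ has type $\mathsf{Set}(T)$ and does not contain $x$. Write $\mathrm{FV}(\varphi)$ for the set of free variables of $\varphi$, and $\varphi\models\psi$ if, for every set of Ur-elements and every assignment of objects of the appropriate types to the variables, $\psi$ holds whenever $\varphi$ does. **Proposition (classical $\Delta_0$ interpolation).** For any $\Delta_0$ formulas $\varphi$ and $\psi$ with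 $\varphi\models\psi$, there is a $\Delta_0$ formula $\theta$ with $\mathrm{FV}(\theta)\subseteq \mathrm{FV}(\varphi)\cap\mathrm{FV}(\psi)$ such that $\varphi\models\theta$ and $\theta\models\psi$. -/

import Mathlib

universe u v

namespace NestedRel

/-- The types of nested relations: `T, U ::= Ur | T × U | Unit | Set(T)`. -/
inductive Ty : Type
  | ur : Ty
  | unit : Ty
  | prod : Ty → Ty → Ty
  | set : Ty → Ty

/-- The objects of each type in the universe over the set `U` of Ur-elements. Sets may be infinite. -/
def Ty.Obj (U : Type u) : Ty → Type u
  | .ur => U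
  | .unit => PUnit
  | .prod S T => Ty.Obj U S × Ty.Obj U T
  | .set T => Set (Ty.Obj U T)

/-- A nested relational schema: `V T` is the collection of variable names declared with type `T`. -/
abbrev Schema : Type (v + 1) := Ty → Type v

/-- An instance of the schema `V` over the Ur-elements `U`: an object of type `T` for every
variable of type `T`. -/
abbrev Instance (U : Type u) (V : Schema.{v}) : Type (max u v) := ∀ T : Ty, V T → T.Obj U

/-- Bound variables (de Bruijn indices): `BVar Γ T` is the set of positions of `T` in the list `Γ` of
types of the enclosing quantifiers, innermost first. -/
inductive BVar : List Ty → Ty → Type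
  | here {Γ : List Ty} {T : Ty} : BVar (T :: Γ) T
  | there {Γ : List Ty} {S T : Ty} : BVar Γ T → BVar (S :: Γ) T

/-- Values for the bound variables in `Γ`. -/
abbrev Env (U : Type u) (Γ : List Ty) : Type u := ∀ T : Ty, BVar Γ T → T.Obj U

/-- The empty environment. -/
def Env.nil (U : Type u) : Env U [] := fun _ x => nomatch x

/-- Extend an environment by a value for a new innermost bound variable. -/
def Env.cons {U : Type u} {Γ : List Ty} {S : Ty} (a : S.Obj U) (e : Env U Γ) : Env U (S :: Γ)
  | _, .here => a
  | _, .there x => e _ x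

/-- Well-typed terms `t, u ::= x | () | ⟨t, u⟩ | π₁ t | π₂ t` over the free variables of the schema `V`
and the bound variables in `Γ`. -/
inductive Term (V : Schema.{v}) (Γ : List Ty) : Ty → Type v
  | fvar {T : Ty} : V T → Term V Γ T
  | bvar {T : Ty} : BVar Γ T → Term V Γ T
  | unit : Term V Γ .unit
  | pair {S T : Ty} : Term V Γ S → Term V Γ T → Term V Γ (.prod S T)
  | fst {S T : Ty} : Term V Γ (.prod S T) → Term V Γ S
  | snd {S T : Ty} : Term V Γ (.prod S T) → Term V Γ T

/-- `Δ₀` formulas: `t =_Ur u | t ≠_Ur u | ⊤ | ⊥ | φ ∨ ψ | φ ∧ ψ | ∀ x ∈_T t, φ | ∃ x ∈_T t, φ`. -/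
inductive Formula (V : Schema.{v}) : List Ty → Type v
  | eq {Γ : List Ty} : Term V Γ .ur → Term V Γ .ur → Formula V Γ
  | neq {Γ : List Ty} : Term V Γ .ur → Term V Γ .ur → Formula V Γ
  | top {Γ : List Ty} : Formula V Γ
  | bot {Γ : List Ty} : Formula V Γ
  | or {Γ : List Ty} : Formula V Γ → Formula V Γ → Formula V Γ
  | and {Γ : List Ty} : Formula V Γ → Formula V Γ → Formula V Γ
  | all {Γ : List Ty} {T : Ty} : Term V Γ (.set T) → Formula V (T :: Γ) → Formula V Γ
  | ex {Γ : List Ty} {T : Ty} : Term V Γ (.set T) → Formula V (T :: Γ) → Formula V Γ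

/-- A `Δ₀` formula over the schema `V`: no bound variable is left dangling. -/
abbrev DeltaZero (V : Schema.{v}) : Type v := Formula V []

/-- The value of a term. -/
def Term.eval {U : Type u} {V : Schema.{v}} {Γ : List Ty} (I : Instance U V) (e : Env U Γ) :
    {T : Ty} → Term V Γ T → T.Obj U
  | _, .fvar x => I _ x
  | _, .bvar x => e _ x
  | _, .unit => PUnit.unit
  | _, .pair t s => (t.eval I e, s.eval I e)
  | _, .fst t => (t.eval I e).1
  | _, .snd t => (t.eval I e).2

/-- Truth of a formula in an instance. -/
def Formula.Holds {U : Type u} {V : Schema.{v}} (I : Instance U V) :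
    {Γ : List Ty} → Env U Γ → Formula V Γ → Prop
  | _, e, .eq t s => t.eval I e = s.eval I e
  | _, e, .neq t s => t.eval I e ≠ s.eval I e
  | _, _, .top => True
  | _, _, .bot => False
  | _, e, .or φ ψ => φ.Holds I e ∨ ψ.Holds I e
  | _, e, .and φ ψ => φ.Holds I e ∧ ψ.Holds I e
  | _, e, .all (T := T) t φ =>
      ∀ a : T.Obj U, a ∈ (show Set (T.Obj U) from t.eval I e) → φ.Holds I (Env.cons a e)
  | _, e, .ex (T := T) t φ =>
      ∃ a : T.Obj U, a ∈ (show Set (T.Obj U) from t.eval I e) ∧ φ.Holds I (Env.cons a e)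

/-- The free variables (with their types) of a term. -/
def Term.FV {V : Schema.{v}} {Γ : List Ty} : {T : Ty} → Term V Γ T → Set (Σ T : Ty, V T)
  | T, .fvar x => {⟨T, x⟩}
  | _, .bvar _ => ∅
  | _, .unit => ∅
  | _, .pair t s => t.FV ∪ s.FV
  | _, .fst t => t.FV
  | _, .snd t => t.FV

/-- The free variables (with their types) of a formula. -/
def Formula.FV {V : Schema.{v}} : {Γ : List Ty} → Formula V Γ → Set (Σ T : Ty, V T)
  | _, .eq t s => t.FV ∪ s.FV
  | _, .neq t s => t.FV ∪ s.FV
  | _, .top => ∅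
  | _, .bot => ∅
  | _, .or φ ψ => φ.FV ∪ ψ.FV
  | _, .and φ ψ => φ.FV ∪ ψ.FV
  | _, .all t φ => t.FV ∪ φ.FV
  | _, .ex t φ => t.FV ∪ φ.FV

/-- `φ ⊨ ψ`: every instance (over any set of Ur-elements) in which `φ` holds is one in which
`ψ` holds. -/
def Entails {V : Schema.{v}} (φ ψ : DeltaZero V) : Prop :=
  ∀ (U : Type u) (I : Instance U V), φ.Holds I (Env.nil U) → ψ.Holds I (Env.nil U)

end NestedRel

universe w

namespace NestedRel

/-! ### Basic facts on `Δ₀` formulas -/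

/-! The proof is a Henkin construction with two theories, which start as `φ` and the negation of
`ψ`. A pair of theories is separable if some `Δ₀` formula in the common variables follows from one
side and is refuted by the other. The two initial formulas are jointly unsatisfiable, and a
separator for them is an interpolant.

Suppose that they are inseparable. Then both sides can be decomposed without ever becoming separable
(`exists_reduces`), because separators obtained after a step yield one before it. A disjunction on
side `b` gives the disjunction of two separators; a conjunction or an instance of a universal
formula leaves the separator unchanged. A fresh element `c` of a set `n` is added to every side on
which `n` lives: if `n` is common, `c` is bound by `∃ c ∈ n`, and otherwise `c` is not common and
cannot occur in the separator (`Sep.of_addWitness`).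

The limit has a model (`holds_value`): Ur-elements are names modulo the equalities asserted by
either side, and a set consists of the values of its asserted elements. Atoms compare only
Ur-elements, so sets need neither extensionality nor congruence. Apart from `⊥`, the only danger is
an inequality whose ends are joined by a chain of equalities from both sides; such a chain yields a
separator (`exists_chain_interpolant`). Hence both initial formulas hold in one model, a
contradiction.

Fresh variables come from `NatSchema`; numbering and substitution lead there from `V` and back. -/

theorem Env.eq_nil {U : Type u} (e : Env U []) : e = Env.nil U := by
  funext T x
  cases x

theorem Term.FV_finite {V : Schema.{v}} {Γ : List Ty} {T : Ty} (t : Term V Γ T) : t.FV.Finite := by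
  induction t with
  | fvar x => exact Set.finite_singleton _
  | bvar x => exact Set.finite_empty
  | unit => exact Set.finite_empty
  | pair t s iht ihs => exact iht.union ihs
  | fst t ih => exact ih
  | snd t ih => exact ih

theorem Formula.FV_finite {V : Schema.{v}} {Γ : List Ty} (φ : Formula V Γ) : φ.FV.Finite := by
  induction φ with
  | eq t s => exact t.FV_finite.union s.FV_finite
  | neq t s => exact t.FV_finite.union s.FV_finite
  | top => exact Set.finite_empty
  | bot => exact Set.finite_empty
  | or φ ψ ihφ ihψ => exact ihφ.union ihψ
  | and φ ψ ihφ ihψ => exact ihφ.union ihψ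
  | all t φ ih => exact t.FV_finite.union ih
  | ex t φ ih => exact t.FV_finite.union ih

theorem Term.eval_congr {U : Type u} {V : Schema.{v}} {Γ : List Ty} {I J : Instance U V}
    (e : Env U Γ) {T : Ty} (t : Term V Γ T) (h : ∀ x ∈ t.FV, I x.1 x.2 = J x.1 x.2) :
    t.eval I e = t.eval J e := by
  induction t with
  | fvar x => exact h ⟨_, x⟩ rfl
  | bvar x => rfl
  | unit => rfl
  | pair t s iht ihs =>
    exact Prod.ext (iht fun x hx => h x (Or.inl hx)) (ihs fun x hx => h x (Or.inr hx))
  | fst t ih => exact congrArg Prod.fst (ih h)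
  | snd t ih => exact congrArg Prod.snd (ih h)

/-- The truth value of a formula depends only on the values of its free variables. -/
theorem Formula.holds_congr {U : Type u} {V : Schema.{v}} {Γ : List Ty} {I J : Instance U V}
    (e : Env U Γ) (φ : Formula V Γ) (h : ∀ x ∈ φ.FV, I x.1 x.2 = J x.1 x.2) :
    φ.Holds I e ↔ φ.Holds J e := by
  induction φ with
  | eq t s =>
    simp only [Formula.Holds, t.eval_congr e fun x hx => h x (Or.inl hx),
      s.eval_congr e fun x hx => h x (Or.inr hx)]
  | neq t s =>
    simp only [Formula.Holds, t.eval_congr e fun x hx => h x (Or.inl hx),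
      s.eval_congr e fun x hx => h x (Or.inr hx)]
  | top => rfl
  | bot => rfl
  | or φ ψ ihφ ihψ =>
    exact or_congr (ihφ e fun x hx => h x (Or.inl hx)) (ihψ e fun x hx => h x (Or.inr hx))
  | and φ ψ ihφ ihψ =>
    exact and_congr (ihφ e fun x hx => h x (Or.inl hx)) (ihψ e fun x hx => h x (Or.inr hx))
  | all t φ ih =>
    simp only [Formula.Holds, t.eval_congr e fun x hx => h x (Or.inl hx),
      fun a => ih (Env.cons a e) fun x hx => h x (Or.inr hx)]
  | ex t φ ih =>
    simp only [Formula.Holds, t.eval_congr e fun x hx => h x (Or.inl hx),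
      fun a => ih (Env.cons a e) fun x hx => h x (Or.inr hx)]

/-- The negation of a `Δ₀` formula, in negation normal form. -/
def Formula.neg {V : Schema.{v}} : {Γ : List Ty} → Formula V Γ → Formula V Γ
  | _, .eq t s => .neq t s
  | _, .neq t s => .eq t s
  | _, .top => .bot
  | _, .bot => .top
  | _, .or φ ψ => .and φ.neg ψ.neg
  | _, .and φ ψ => .or φ.neg ψ.neg
  | _, .all t φ => .ex t φ.neg
  | _, .ex t φ => .all t φ.neg

theorem Formula.FV_neg {V : Schema.{v}} {Γ : List Ty} (φ : Formula V Γ) : φ.neg.FV = φ.FV := by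
  induction φ <;> simp_all [Formula.neg, Formula.FV]

theorem Formula.holds_neg {U : Type u} {V : Schema.{v}} {Γ : List Ty} (I : Instance U V)
    (e : Env U Γ) (φ : Formula V Γ) : φ.neg.Holds I e ↔ ¬ φ.Holds I e := by
  induction φ with
  | eq t s => rfl
  | neq t s => simp [Formula.neg, Formula.Holds]
  | top => simp [Formula.neg, Formula.Holds]
  | bot => simp [Formula.neg, Formula.Holds]
  | or φ ψ ihφ ihψ => simp [Formula.neg, Formula.Holds, ihφ, ihψ]
  | and φ ψ ihφ ihψ => simp only [Formula.neg, Formula.Holds, ihφ, ihψ, not_and_or]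
  | all t φ ih => simp [Formula.neg, Formula.Holds, ih]
  | ex t φ ih => simp [Formula.neg, Formula.Holds, ih]

/-! ### Change of the set of Ur-elements -/

/-- The action of a map of Ur-elements on objects. -/
def Ty.map {U : Type u} {U' : Type v} (f : U → U') : (T : Ty) → T.Obj U → T.Obj U'
  | .ur => f
  | .unit => fun _ => PUnit.unit
  | .prod S T => fun a => (S.map f a.1, T.map f a.2)
  | .set T => fun a => T.map f '' (show Set (T.Obj U) from a)

theorem Ty.map_cons {U : Type u} {U' : Type*} (f : U → U') {Γ : List Ty} {S : Ty} (a : S.Obj U)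
    (e : Env U Γ) :
    (fun T x => T.map f (Env.cons a e T x)) = Env.cons (S.map f a) fun T x => T.map f (e T x) := by
  funext T x
  cases x <;> rfl

theorem Term.eval_map {U : Type u} {U' : Type*} (f : U → U') {V : Schema.{v}} {Γ : List Ty}
    (I : Instance U V) (e : Env U Γ) {T : Ty} (t : Term V Γ T) :
    t.eval (fun T x => T.map f (I T x)) (fun T x => T.map f (e T x)) = T.map f (t.eval I e) := by
  induction t with
  | fvar x => rfl
  | bvar x => rfl
  | unit => rfl
  | pair t s iht ihs => exact Prod.ext iht ihs
  | fst t ih => exact congrArg Prod.fst ih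
  | snd t ih => exact congrArg Prod.snd ih

/-- `Δ₀` formulas are invariant under injections of the Ur-elements. -/
theorem Formula.holds_map {U : Type u} {U' : Type*} {f : U → U'} (hf : f.Injective)
    {V : Schema.{v}} {Γ : List Ty} (I : Instance U V) (e : Env U Γ) (φ : Formula V Γ) :
    φ.Holds (fun T x => T.map f (I T x)) (fun T x => T.map f (e T x)) ↔ φ.Holds I e := by
  induction φ with
  | eq t s =>
    simp only [Formula.Holds, Term.eval_map]
    exact hf.eq_iff
  | neq t s =>
    simp only [Formula.Holds, Term.eval_map]
    exact hf.ne_iff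
  | top => rfl
  | bot => rfl
  | or φ ψ ihφ ihψ => exact or_congr (ihφ e) (ihψ e)
  | and φ ψ ihφ ihψ => exact and_congr (ihφ e) (ihψ e)
  | all t φ ih =>
    simp only [Formula.Holds, Term.eval_map]
    -- The elements of a transported set are exactly the images of the original elements, so a
    -- bounded quantifier never sees Ur-elements outside the range of `f`.
    refine Set.forall_mem_image.trans (forall₂_congr fun a _ => ?_)
    rw [← Ty.map_cons]
    exact ih _
  | ex t φ ih =>
    simp only [Formula.Holds, Term.eval_map]
    refine Set.exists_mem_image.trans (exists_congr fun a => and_congr_right fun _ => ?_)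
    rw [← Ty.map_cons]
    exact ih _

theorem Formula.holds_map_nil {U : Type u} {U' : Type*} {f : U → U'} (hf : f.Injective)
    {V : Schema.{v}} (I : Instance U V) (φ : DeltaZero V) :
    φ.Holds (fun T x => T.map f (I T x)) (Env.nil U') ↔ φ.Holds I (Env.nil U) := by
  rw [← Formula.holds_map hf I, Env.eq_nil fun T x => T.map f (Env.nil U T x)]

theorem Ty.nonempty_obj (U : Type u) [Nonempty U] : (T : Ty) → Nonempty (T.Obj U)
  | .ur => ‹Nonempty U›
  | .unit => ⟨PUnit.unit⟩
  | .prod S T => by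
    obtain ⟨a⟩ := Ty.nonempty_obj U S
    obtain ⟨b⟩ := Ty.nonempty_obj U T
    exact ⟨(a, b)⟩
  | .set T => ⟨(∅ : Set (T.Obj U))⟩

/-! ### Substitution -/

/-- Weaken a term by a new innermost bound variable. -/
def Term.weaken {V : Schema.{v}} {Γ : List Ty} (S : Ty) :
    {T : Ty} → Term V Γ T → Term V (S :: Γ) T
  | _, .fvar x => .fvar x
  | _, .bvar x => .bvar (.there x)
  | _, .unit => .unit
  | _, .pair t s => .pair (t.weaken S) (s.weaken S)
  | _, .fst t => .fst (t.weaken S)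
  | _, .snd t => .snd (t.weaken S)

theorem Term.FV_weaken {V : Schema.{v}} {Γ : List Ty} (S : Ty) {T : Ty} (t : Term V Γ T) :
    (t.weaken S).FV = t.FV := by
  induction t <;> simp_all [Term.weaken, Term.FV]

theorem Term.eval_weaken {U : Type u} {V : Schema.{v}} {Γ : List Ty} {S : Ty} (I : Instance U V)
    (e : Env U Γ) (a : S.Obj U) {T : Ty} (t : Term V Γ T) :
    (t.weaken S).eval I (Env.cons a e) = t.eval I e := by
  induction t with
  | fvar x => rfl
  | bvar x => rfl
  | unit => rfl
  | pair t s iht ihs => exact Prod.ext iht ihs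
  | fst t ih => exact congrArg Prod.fst ih
  | snd t ih => exact congrArg Prod.snd ih

theorem Term.exists_subst {W : Schema.{u}} {W' : Schema.{v}} {Γ Γ' : List Ty} {T : Ty}
    (t : Term W Γ T) {S : Set (Σ T, W T)} {C : Set (Σ T, W' T)} (hS : t.FV ⊆ S)
    (σ : ∀ x ∈ S, Term W' Γ' x.1) (τ : ∀ T, BVar Γ T → Term W' Γ' T)
    (hσ : ∀ x hx, (σ x hx).FV ⊆ C) (hτ : ∀ T x, (τ T x).FV ⊆ C) :
    ∃ t' : Term W' Γ' T, t'.FV ⊆ C ∧ ∀ (U : Type w) (I : Instance U W) (e : Env U Γ)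
      (I' : Instance U W') (e' : Env U Γ'), (∀ x hx, (σ x hx).eval I' e' = I x.1 x.2) →
      (∀ T x, (τ T x).eval I' e' = e T x) → t'.eval I' e' = t.eval I e := by
  induction t with
  | fvar x =>
    exact ⟨σ ⟨_, x⟩ (hS rfl), hσ _ _, fun U I e I' e' h _ => h ⟨_, x⟩ (hS rfl)⟩
  | bvar x => exact ⟨τ _ x, hτ _ _, fun U I e I' e' _ h => h _ x⟩
  | unit => exact ⟨.unit, Set.empty_subset _, fun U I e I' e' _ _ => rfl⟩
  | pair t s iht ihs =>
    obtain ⟨t', ht, ht'⟩ := iht (Set.union_subset_iff.1 hS).1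
    obtain ⟨s', hs, hs'⟩ := ihs (Set.union_subset_iff.1 hS).2
    exact ⟨.pair t' s', Set.union_subset ht hs, fun U I e I' e' h₁ h₂ =>
      Prod.ext (ht' U I e I' e' h₁ h₂) (hs' U I e I' e' h₁ h₂)⟩
  | fst t ih =>
    obtain ⟨t', ht, ht'⟩ := ih hS
    exact ⟨.fst t', ht, fun U I e I' e' h₁ h₂ => congrArg Prod.fst (ht' U I e I' e' h₁ h₂)⟩
  | snd t ih =>
    obtain ⟨t', ht, ht'⟩ := ih hS
    exact ⟨.snd t', ht, fun U I e I' e' h₁ h₂ => congrArg Prod.snd (ht' U I e I' e' h₁ h₂)⟩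

/-- Simultaneous substitution of terms for the bound variables and the free variables in `S`. -/
theorem Formula.exists_subst {W : Schema.{u}} {W' : Schema.{v}} {Γ : List Ty}
    (φ : Formula W Γ) {S : Set (Σ T, W T)} {C : Set (Σ T, W' T)} (hS : φ.FV ⊆ S) {Γ' : List Ty}
    (σ : ∀ x ∈ S, Term W' Γ' x.1) (τ : ∀ T, BVar Γ T → Term W' Γ' T)
    (hσ : ∀ x hx, (σ x hx).FV ⊆ C) (hτ : ∀ T x, (τ T x).FV ⊆ C) :
    ∃ φ' : Formula W' Γ', φ'.FV ⊆ C ∧ ∀ (U : Type w) (I : Instance U W) (e : Env U Γ)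
      (I' : Instance U W') (e' : Env U Γ'), (∀ x hx, (σ x hx).eval I' e' = I x.1 x.2) →
      (∀ T x, (τ T x).eval I' e' = e T x) → (φ'.Holds I' e' ↔ φ.Holds I e) := by
  -- Passing under a quantifier: the new bound variable goes to itself, and every substituted term
  -- is weakened, so nothing is captured.
  have lift : ∀ {Γ Γ' : List Ty} {R : Ty} (σ : ∀ x ∈ S, Term W' Γ' x.1)
      (τ : ∀ T, BVar Γ T → Term W' Γ' T) (hσ : ∀ x hx, (σ x hx).FV ⊆ C)
      (hτ : ∀ T x, (τ T x).FV ⊆ C), ∃ τ' : ∀ T, BVar (R :: Γ) T → Term W' (R :: Γ') T,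
      (∀ x hx, ((σ x hx).weaken R).FV ⊆ C) ∧ (∀ T x, (τ' T x).FV ⊆ C) ∧
      ∀ (U : Type w) (I : Instance U W) (e : Env U Γ) (I' : Instance U W') (e' : Env U Γ')
      (a : R.Obj U), (∀ x hx, (σ x hx).eval I' e' = I x.1 x.2) →
      (∀ T x, (τ T x).eval I' e' = e T x) →
      (∀ x hx, ((σ x hx).weaken R).eval I' (Env.cons a e') = I x.1 x.2) ∧
      (∀ T x, (τ' T x).eval I' (Env.cons a e') = Env.cons a e T x) := by
    intro Γ Γ' R σ τ hσ hτ
    refine ⟨fun T x => match x with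
      | .here => .bvar .here
      | .there x => (τ _ x).weaken R, fun x hx => ?_, fun T x => ?_, ?_⟩
    · rw [Term.FV_weaken]
      exact hσ x hx
    · cases x with
      | here => exact Set.empty_subset _
      | there x => exact (Term.FV_weaken R _).trans_subset (hτ _ x)
    · refine fun U I e I' e' a h₁ h₂ => ⟨fun x hx => ?_, fun T x => ?_⟩
      · rw [Term.eval_weaken, h₁]
      · cases x with
        | here => rfl
        | there x => exact (Term.eval_weaken _ _ _ _).trans (h₂ _ x)
  induction φ generalizing Γ' with
  | eq t s =>
    obtain ⟨t', ht, ht'⟩ := Term.exists_subst.{u, v, w} t (Set.union_subset_iff.1 hS).1 σ τ hσ hτ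
    obtain ⟨s', hs, hs'⟩ := Term.exists_subst.{u, v, w} s (Set.union_subset_iff.1 hS).2 σ τ hσ hτ
    exact ⟨.eq t' s', Set.union_subset ht hs, fun U I e I' e' h₁ h₂ => by
      simp only [Formula.Holds, ht' U I e I' e' h₁ h₂, hs' U I e I' e' h₁ h₂]⟩
  | neq t s =>
    obtain ⟨t', ht, ht'⟩ := Term.exists_subst.{u, v, w} t (Set.union_subset_iff.1 hS).1 σ τ hσ hτ
    obtain ⟨s', hs, hs'⟩ := Term.exists_subst.{u, v, w} s (Set.union_subset_iff.1 hS).2 σ τ hσ hτ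
    exact ⟨.neq t' s', Set.union_subset ht hs, fun U I e I' e' h₁ h₂ => by
      simp only [Formula.Holds, ht' U I e I' e' h₁ h₂, hs' U I e I' e' h₁ h₂]⟩
  | top => exact ⟨.top, Set.empty_subset _, fun U I e I' e' _ _ => Iff.rfl⟩
  | bot => exact ⟨.bot, Set.empty_subset _, fun U I e I' e' _ _ => Iff.rfl⟩
  | or φ ψ ihφ ihψ =>
    obtain ⟨φ', hφ, hφ'⟩ := ihφ (Set.union_subset_iff.1 hS).1 σ τ hσ hτ
    obtain ⟨ψ', hψ, hψ'⟩ := ihψ (Set.union_subset_iff.1 hS).2 σ τ hσ hτ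
    exact ⟨.or φ' ψ', Set.union_subset hφ hψ, fun U I e I' e' h₁ h₂ =>
      or_congr (hφ' U I e I' e' h₁ h₂) (hψ' U I e I' e' h₁ h₂)⟩
  | and φ ψ ihφ ihψ =>
    obtain ⟨φ', hφ, hφ'⟩ := ihφ (Set.union_subset_iff.1 hS).1 σ τ hσ hτ
    obtain ⟨ψ', hψ, hψ'⟩ := ihψ (Set.union_subset_iff.1 hS).2 σ τ hσ hτ
    exact ⟨.and φ' ψ', Set.union_subset hφ hψ, fun U I e I' e' h₁ h₂ =>
      and_congr (hφ' U I e I' e' h₁ h₂) (hψ' U I e I' e' h₁ h₂)⟩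
  | all t φ ih =>
    obtain ⟨t', ht, ht'⟩ := Term.exists_subst.{u, v, w} t (Set.union_subset_iff.1 hS).1 σ τ hσ hτ
    obtain ⟨τ', hσ', hτ', h'⟩ := lift σ τ hσ hτ
    obtain ⟨φ', hφ, hφ'⟩ := ih (Set.union_subset_iff.1 hS).2 _ τ' hσ' hτ'
    refine ⟨.all t' φ', Set.union_subset ht hφ, fun U I e I' e' h₁ h₂ => ?_⟩
    simp only [Formula.Holds, ht' U I e I' e' h₁ h₂]
    exact forall₂_congr fun a _ =>
      hφ' U I _ I' _ (h' U I e I' e' a h₁ h₂).1 (h' U I e I' e' a h₁ h₂).2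
  | ex t φ ih =>
    obtain ⟨t', ht, ht'⟩ := Term.exists_subst.{u, v, w} t (Set.union_subset_iff.1 hS).1 σ τ hσ hτ
    obtain ⟨τ', hσ', hτ', h'⟩ := lift σ τ hσ hτ
    obtain ⟨φ', hφ, hφ'⟩ := ih (Set.union_subset_iff.1 hS).2 _ τ' hσ' hτ'
    refine ⟨.ex t' φ', Set.union_subset ht hφ, fun U I e I' e' h₁ h₂ => ?_⟩
    simp only [Formula.Holds, ht' U I e I' e' h₁ h₂]
    exact exists_congr fun a => and_congr_right fun _ =>
      hφ' U I _ I' _ (h' U I e I' e' a h₁ h₂).1 (h' U I e I' e' a h₁ h₂).2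

/-! ### Names -/

/-- A countable supply of variables of every type. -/
abbrev NatSchema : Schema.{0} := fun _ => ℕ

/-- The variables of `NatSchema`, with their types. -/
abbrev Var : Type := Σ T : Ty, NatSchema T

/-- A value for each variable can be changed at one variable. -/
theorem exists_update {U : Type u} (ρ : Instance U NatSchema) (T : Ty) (c : ℕ) (a : T.Obj U) :
    ∃ ρ' : Instance U NatSchema, ρ' T c = a ∧ ∀ x : Var, x ≠ ⟨T, c⟩ → ρ' x.1 x.2 = ρ x.1 x.2 := by
  classical
  let f : ∀ x : Var, x.1.Obj U := Function.update (fun x => ρ x.1 x.2) ⟨T, c⟩ a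
  refine ⟨fun S k => f ⟨S, k⟩, Function.update_self .., fun x hx => Function.update_of_ne hx ..⟩

/-- Iterated projections of a variable. -/
inductive Neutral : Ty → Type
  | var {T : Ty} : ℕ → Neutral T
  | fst {S T : Ty} : Neutral (.prod S T) → Neutral S
  | snd {S T : Ty} : Neutral (.prod S T) → Neutral T

/-- The variable that is projected. -/
def Neutral.head : {T : Ty} → Neutral T → Var
  | T, .var k => ⟨T, k⟩
  | _, .fst n => n.head
  | _, .snd n => n.head

/-- The value of an iterated projection. -/
def Neutral.eval {U : Type u} (ρ : Instance U NatSchema) : {T : Ty} → Neutral T → T.Obj U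
  | T, .var k => ρ T k
  | _, .fst n => (n.eval ρ).1
  | _, .snd n => (n.eval ρ).2

/-- An iterated projection as a term. -/
def Neutral.toTerm : {T : Ty} → Neutral T → Term NatSchema [] T
  | _, .var k => .fvar k
  | _, .fst n => .fst n.toTerm
  | _, .snd n => .snd n.toTerm

theorem Neutral.FV_toTerm {T : Ty} (n : Neutral T) : n.toTerm.FV = {n.head} := by
  induction n with
  | var k => rfl
  | fst n ih => exact ih
  | snd n ih => exact ih

theorem Neutral.eval_toTerm {U : Type u} (ρ : Instance U NatSchema) (e : Env U []) {T : Ty}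
    (n : Neutral T) : n.toTerm.eval ρ e = n.eval ρ := by
  induction n with
  | var k => rfl
  | fst n ih => exact congrArg Prod.fst ih
  | snd n ih => exact congrArg Prod.snd ih

theorem Neutral.eval_congr {U : Type u} {ρ ρ' : Instance U NatSchema} {T : Ty} (n : Neutral T)
    (h : ρ n.head.1 n.head.2 = ρ' n.head.1 n.head.2) : n.eval ρ = n.eval ρ' := by
  induction n with
  | var k => exact h
  | fst n ih => exact congrArg Prod.fst (ih h)
  | snd n ih => exact congrArg Prod.snd (ih h)

/-- Terms in normal form: tuples of iterated projections of type `Ur` or of some set type. -/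
def Name : Ty → Type
  | .ur => Neutral .ur
  | .unit => PUnit
  | .prod S T => Name S × Name T
  | .set T => Neutral (.set T)

/-- The normal form of an iterated projection. -/
def Neutral.reflect : (T : Ty) → Neutral T → Name T
  | .ur => fun n => n
  | .unit => fun _ => PUnit.unit
  | .prod S T => fun n => (Neutral.reflect S n.fst, Neutral.reflect T n.snd)
  | .set _ => fun n => n

/-- The value of a name. -/
def Name.eval {U : Type u} (ρ : Instance U NatSchema) : (T : Ty) → Name T → T.Obj U
  | .ur => fun n => Neutral.eval ρ n
  | .unit => fun _ => PUnit.unit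
  | .prod S T => fun n => (Name.eval ρ S n.1, Name.eval ρ T n.2)
  | .set _ => fun n => Neutral.eval ρ n

/-- All variables of the name lie in `A`. -/
def Name.Over (A : Set Var) : (T : Ty) → Name T → Prop
  | .ur => fun n => Neutral.head n ∈ A
  | .unit => fun _ => True
  | .prod S T => fun n => Name.Over A S n.1 ∧ Name.Over A T n.2
  | .set _ => fun n => Neutral.head n ∈ A

theorem Name.Over.mono {A B : Set Var} (h : A ⊆ B) :
    {T : Ty} → {n : Name T} → n.Over A → n.Over B
  | .ur, _, hn => h hn
  | .unit, _, _ => trivial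
  | .prod _ _, _, hn => ⟨hn.1.mono h, hn.2.mono h⟩
  | .set _, _, hn => h hn

theorem Name.eval_congr {U : Type u} {A : Set Var} {ρ ρ' : Instance U NatSchema}
    (h : ∀ x ∈ A, ρ x.1 x.2 = ρ' x.1 x.2) :
    {T : Ty} → {n : Name T} → n.Over A → n.eval ρ = n.eval ρ'
  | .ur, n, hn => Neutral.eval_congr n (h _ hn)
  | .unit, _, _ => rfl
  | .prod _ _, _, hn => Prod.ext (Name.eval_congr h hn.1) (Name.eval_congr h hn.2)
  | .set _, n, hn => Neutral.eval_congr n (h _ hn)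

theorem Neutral.over_reflect {A : Set Var} :
    {T : Ty} → (n : Neutral T) → n.head ∈ A → (n.reflect T).Over A
  | .ur, _, h => h
  | .unit, _, _ => trivial
  | .prod _ _, n, h => ⟨n.fst.over_reflect h, n.snd.over_reflect h⟩
  | .set _, _, h => h

theorem Neutral.eval_reflect {U : Type u} (ρ : Instance U NatSchema) :
    {T : Ty} → (n : Neutral T) → (n.reflect T).eval ρ = n.eval ρ
  | .ur, _ => rfl
  | .unit, _ => rfl
  | .prod _ _, n => Prod.ext (n.fst.eval_reflect ρ) (n.snd.eval_reflect ρ)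
  | .set _, _ => rfl

/-- Names for the bound variables in `Γ`. -/
abbrev NameEnv (Γ : List Ty) : Type := ∀ T : Ty, BVar Γ T → Name T

/-- Extend an environment of names by a name for a new innermost bound variable. -/
def NameEnv.cons {Γ : List Ty} {S : Ty} (a : Name S) (e : NameEnv Γ) : NameEnv (S :: Γ)
  | _, .here => a
  | _, .there x => e _ x

theorem NameEnv.map_cons {U : Type u} (v : ∀ T : Ty, Name T → T.Obj U) {Γ : List Ty} {S : Ty}
    (a : Name S) (e : NameEnv Γ) :
    (fun T x => v T (NameEnv.cons a e T x)) = Env.cons (v S a) fun T x => v T (e T x) := by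
  funext T x
  cases x <;> rfl

/-- The name of a variable. -/
def Name.ofVar (T : Ty) (k : ℕ) : Name T := (Neutral.var k).reflect T

/-- The normal form of a term, where free variables are numbered by `ι`. -/
def Term.nf {V : Schema.{v}} (ι : ∀ T, V T → ℕ) {Γ : List Ty} (e : NameEnv Γ) :
    {T : Ty} → Term V Γ T → Name T
  | T, .fvar x => Name.ofVar T (ι T x)
  | _, .bvar x => e _ x
  | _, .unit => PUnit.unit
  | _, .pair t s => (t.nf ι e, s.nf ι e)
  | _, .fst t => (t.nf ι e).1
  | _, .snd t => (t.nf ι e).2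

theorem Term.over_nf {V : Schema.{v}} {ι : ∀ T, V T → ℕ} {A : Set Var} {Γ : List Ty}
    {e : NameEnv Γ} (he : ∀ T x, (e T x).Over A) {T : Ty} (t : Term V Γ T)
    (ht : ∀ x ∈ t.FV, (⟨x.1, ι x.1 x.2⟩ : Var) ∈ A) : (t.nf ι e).Over A := by
  induction t with
  | fvar x => exact Neutral.over_reflect _ (ht _ rfl)
  | bvar x => exact he _ x
  | unit => trivial
  | pair t s iht ihs => exact ⟨iht fun x hx => ht x (Or.inl hx), ihs fun x hx => ht x (Or.inr hx)⟩
  | fst t ih => exact (ih ht).1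
  | snd t ih => exact (ih ht).2

/-- An interpretation of names by objects that respects pairs. -/
def RespectsPairs {U : Type u} (v : ∀ T : Ty, Name T → T.Obj U) : Prop :=
  ∀ (S T : Ty) (a : Name S) (b : Name T), v (.prod S T) (a, b) = (v S a, v T b)

theorem Name.respectsPairs_eval {U : Type u} (ρ : Instance U NatSchema) :
    RespectsPairs (Name.eval ρ) := fun _ _ _ _ => rfl

/-- The instance given by an interpretation of names and a numbering of the variables. -/
abbrev instanceOf {U : Type u} {V : Schema.{v}} (ι : ∀ T, V T → ℕ)
    (v : ∀ T : Ty, Name T → T.Obj U) : Instance U V := fun T x => v T (Name.ofVar T (ι T x))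

/-- Normalisation only contracts projections of pairs and expands variables, so respecting pairs
suffices for soundness. The generality serves two interpretations: `Name.eval ρ` for separators and
`value S` for the limit model. -/
theorem Term.eval_nf {U : Type u} {v : ∀ T : Ty, Name T → T.Obj U} (hv : RespectsPairs v)
    {V : Schema.{v}} (ι : ∀ T, V T → ℕ) {Γ : List Ty} (e : NameEnv Γ) {T : Ty} (t : Term V Γ T) :
    t.eval (instanceOf ι v) (fun T x => v T (e T x)) = v T (t.nf ι e) := by
  induction t with
  | fvar x => rfl
  | bvar x => rfl
  | unit => rfl
  | pair t s iht ihs => exact (Prod.ext iht ihs : _ = (_, _)).trans (hv _ _ _ _).symm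
  | fst t ih => exact congrArg Prod.fst (ih.trans (hv _ _ _ _))
  | snd t ih => exact congrArg Prod.snd (ih.trans (hv _ _ _ _))

/-! ### Pairs of theories -/

/-- A formula whose bound variables are instantiated by names. -/
structure Item (V : Schema.{v}) where
  /-- The types of the bound variables. -/
  {ctx : List Ty}
  /-- The formula. -/
  form : Formula V ctx
  /-- The names of the bound variables. -/
  env : NameEnv ctx

/-- Truth of an instantiated formula. -/
def Item.Holds {U : Type u} {V : Schema.{v}} (ι : ∀ T, V T → ℕ)
    (v : ∀ T : Ty, Name T → T.Obj U) (i : Item V) : Prop :=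
  i.form.Holds (instanceOf ι v) fun T x => v T (i.env T x)

/-- All variables of the instantiated formula lie in `A`. -/
def Item.Over {V : Schema.{v}} (ι : ∀ T, V T → ℕ) (A : Set Var) (i : Item V) : Prop :=
  (∀ x ∈ i.form.FV, (⟨x.1, ι x.1 x.2⟩ : Var) ∈ A) ∧ ∀ T x, (i.env T x).Over A

theorem Item.Over.mono {V : Schema.{v}} {ι : ∀ T, V T → ℕ} {A B : Set Var} (h : A ⊆ B)
    {i : Item V} (hi : i.Over ι A) : i.Over ι B :=
  ⟨fun x hx => h (hi.1 x hx), fun T x => (hi.2 T x).mono h⟩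

theorem Item.holds_congr {U : Type u} {V : Schema.{v}} {ι : ∀ T, V T → ℕ} {A : Set Var}
    {ρ ρ' : Instance U NatSchema} (h : ∀ x ∈ A, ρ x.1 x.2 = ρ' x.1 x.2) {i : Item V}
    (hi : i.Over ι A) : i.Holds ι (Name.eval ρ) ↔ i.Holds ι (Name.eval ρ') := by
  have henv : (fun T x => (i.env T x).eval ρ) = fun T x => (i.env T x).eval ρ' := by
    funext T x
    exact Name.eval_congr h (hi.2 T x)
  unfold Item.Holds
  rw [henv]
  exact Formula.holds_congr _ _ fun x hx =>
    Name.eval_congr h (Neutral.over_reflect _ (hi.1 x hx))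

/-- A membership assertion `c ∈ n`, where `c` is a variable. -/
structure Mem where
  /-- The type of the element. -/
  ty : Ty
  /-- The element. -/
  elt : ℕ
  /-- The set. -/
  bound : Neutral (.set ty)

/-- Truth of a membership assertion. -/
def Mem.Holds {U : Type u} (ρ : Instance U NatSchema) (m : Mem) : Prop :=
  ρ m.ty m.elt ∈ (show Set (m.ty.Obj U) from m.bound.eval ρ)

/-- A pair of finite theories, one for each side, each over its own finite set of variables.
A membership assertion on one side whose set is a name of the other side is shared. -/
structure State {V : Schema.{v}} (ι : ∀ T, V T → ℕ) where
  /-- The variables of each side. -/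
  vars : Bool → Set Var
  /-- The instantiated formulas of each side. -/
  items : Bool → Set (Item V)
  /-- The membership assertions of each side. -/
  mems : Bool → Set Mem
  finite_vars : ∀ b, (vars b).Finite
  finite_items : ∀ b, (items b).Finite
  finite_mems : ∀ b, (mems b).Finite
  over_items : ∀ b, ∀ i ∈ items b, i.Over ι (vars b)
  over_mems : ∀ b, ∀ m ∈ mems b, (⟨m.ty, m.elt⟩ : Var) ∈ vars b ∧ m.bound.head ∈ vars b
  shared : ∀ b b', ∀ m ∈ mems b', m.bound.head ∈ vars b → m ∈ mems b

/-! ### Satisfaction, separability and extension of states -/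

namespace State

variable {V : Schema.{v}} {ι : ∀ T, V T → ℕ}

/-- Extension of states. -/
def Le (s s' : State ι) : Prop :=
  ∀ b, s.vars b ⊆ s'.vars b ∧ s.items b ⊆ s'.items b ∧ s.mems b ⊆ s'.mems b

theorem Le.rfl {s : State ι} : s.Le s := fun _ => ⟨subset_rfl, subset_rfl, subset_rfl⟩

theorem Le.trans {s₁ s₂ s₃ : State ι} (h : s₁.Le s₂) (h' : s₂.Le s₃) : s₁.Le s₃ := fun b =>
  ⟨(h b).1.trans (h' b).1, (h b).2.1.trans (h' b).2.1, (h b).2.2.trans (h' b).2.2⟩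

/-- The valuation `ρ` satisfies the theory of side `b`. -/
def Sat {U : Type u} (s : State ι) (ρ : Instance U NatSchema) (b : Bool) : Prop :=
  (∀ i ∈ s.items b, i.Holds ι (Name.eval ρ)) ∧ ∀ m ∈ s.mems b, m.Holds ρ

theorem sat_congr {U : Type u} (s : State ι) {ρ ρ' : Instance U NatSchema} {b : Bool}
    (h : ∀ x ∈ s.vars b, ρ x.1 x.2 = ρ' x.1 x.2) (hs : s.Sat ρ b) : s.Sat ρ' b := by
  refine ⟨fun i hi => (Item.holds_congr h (s.over_items b i hi)).1 (hs.1 i hi), fun m hm => ?_⟩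
  have hm' := s.over_mems b m hm
  have := hs.2 m hm
  unfold Mem.Holds at this ⊢
  rwa [← Neutral.eval_congr m.bound (h _ hm'.2), ← h _ hm'.1]

/-- A formula in the common variables separates side `b` from the other side. -/
def Sep (s : State ι) (b : Bool) : Prop :=
  ∃ θ : DeltaZero NatSchema, θ.FV ⊆ s.vars b ∩ s.vars (!b) ∧
    ∀ (U : Type u) (ρ : Instance U NatSchema), (s.Sat ρ b → θ.Holds ρ (Env.nil U)) ∧
      (s.Sat ρ (!b) → ¬ θ.Holds ρ (Env.nil U))

theorem Sep.not {s : State ι} {b : Bool} (h : Sep.{u} s b) : Sep.{u} s (!b) := by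
  obtain ⟨θ, hθ, h⟩ := h
  refine ⟨θ.neg, ?_, fun U ρ => ?_⟩
  · rwa [Formula.FV_neg, Bool.not_not, Set.inter_comm]
  · rw [Formula.holds_neg, Bool.not_not, not_not]
    exact (h U ρ).symm

/-- Negating a separator exchanges the two sides, so each later step may choose the side on which it
acts. -/
theorem Sep.side {s : State ι} {b : Bool} (h : Sep.{u} s b) (b' : Bool) : Sep.{u} s b' := by
  rcases Bool.eq_or_eq_not b' b with rfl | rfl
  · exact h
  · exact h.not

/-- Add instantiated formulas to side `b`. -/
def addItems (s : State ι) (b : Bool) (J : Set (Item V)) (hJ : J.Finite)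
    (hJ' : ∀ i ∈ J, i.Over ι (s.vars b)) : State ι where
  vars := s.vars
  items b' := s.items b' ∪ {i | b' = b ∧ i ∈ J}
  mems := s.mems
  finite_vars := s.finite_vars
  finite_items b' := (s.finite_items b').union (hJ.subset fun _ h => h.2)
  finite_mems := s.finite_mems
  over_items b' i hi := by
    rcases hi with hi | ⟨rfl, hi⟩
    · exact s.over_items b' i hi
    · exact hJ' i hi
  over_mems := s.over_mems
  shared := s.shared

theorem le_addItems (s : State ι) (b : Bool) (J : Set (Item V)) (hJ : J.Finite)
    (hJ' : ∀ i ∈ J, i.Over ι (s.vars b)) : s.Le (s.addItems b J hJ hJ') := fun _ =>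
  ⟨subset_rfl, Set.subset_union_left, subset_rfl⟩

theorem sat_addItems_self {U : Type u} {s : State ι} {b : Bool} {J : Set (Item V)} {hJ : J.Finite}
    {hJ' : ∀ i ∈ J, i.Over ι (s.vars b)} {ρ : Instance U NatSchema} (h : s.Sat ρ b)
    (h' : ∀ i ∈ J, i.Holds ι (Name.eval ρ)) : (s.addItems b J hJ hJ').Sat ρ b :=
  ⟨fun i hi => hi.elim (h.1 i) fun hi => h' i hi.2, h.2⟩

theorem sat_addItems_not {U : Type u} {s : State ι} {b : Bool} {J : Set (Item V)} {hJ : J.Finite}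
    {hJ' : ∀ i ∈ J, i.Over ι (s.vars b)} {ρ : Instance U NatSchema} (h : s.Sat ρ (!b)) :
    (s.addItems b J hJ hJ').Sat ρ (!b) :=
  ⟨fun i hi => hi.elim (h.1 i) fun hi => absurd hi.1 (Bool.not_ne_self b), h.2⟩

theorem Sep.of_addItems {s : State ι} {b : Bool} {J : Set (Item V)} {hJ : J.Finite}
    {hJ' : ∀ i ∈ J, i.Over ι (s.vars b)} (h : Sep.{u} (s.addItems b J hJ hJ') b)
    (H : ∀ (U : Type u) (ρ : Instance U NatSchema), s.Sat ρ b → ∀ i ∈ J, i.Holds ι (Name.eval ρ)) :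
    Sep.{u} s b := by
  obtain ⟨θ, hθ, h⟩ := h
  exact ⟨θ, hθ, fun U ρ => ⟨fun hs => (h U ρ).1 (sat_addItems_self hs (H U ρ hs)),
    fun hs => (h U ρ).2 (sat_addItems_not hs)⟩⟩

/-- The other side is the same in both extensions, so it refutes both separators and hence their
disjunction. -/
theorem Sep.of_addItems_or {s : State ι} {b : Bool} {i j : Item V} {hi hi' hj hj'}
    (h₁ : Sep.{u} (s.addItems b {i} hi hi') b) (h₂ : Sep.{u} (s.addItems b {j} hj hj') b)
    (H : ∀ (U : Type u) (ρ : Instance U NatSchema), s.Sat ρ b →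
      i.Holds ι (Name.eval ρ) ∨ j.Holds ι (Name.eval ρ)) : Sep.{u} s b := by
  obtain ⟨θ₁, hθ₁, h₁⟩ := h₁
  obtain ⟨θ₂, hθ₂, h₂⟩ := h₂
  refine ⟨.or θ₁ θ₂, Set.union_subset hθ₁ hθ₂, fun U ρ => ⟨fun hs => ?_, fun hs => ?_⟩⟩
  · refine (H U ρ hs).imp (fun hh => ?_) (fun hh => ?_)
    · exact (h₁ U ρ).1 (sat_addItems_self hs fun k hk => hk ▸ hh)
    · exact (h₂ U ρ).1 (sat_addItems_self hs fun k hk => hk ▸ hh)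
  · exact not_or.2 ⟨(h₁ U ρ).2 (sat_addItems_not hs), (h₂ U ρ).2 (sat_addItems_not hs)⟩

/-- Add a new variable `c` with the assertion `c ∈ n` to every side to which `n` belongs. -/
def addWitness (s : State ι) {T : Ty} (c : ℕ) (n : Neutral (.set T))
    (hc : ∀ b, (⟨T, c⟩ : Var) ∉ s.vars b) : State ι where
  vars b := s.vars b ∪ {x | x = ⟨T, c⟩ ∧ n.head ∈ s.vars b}
  items := s.items
  mems b := s.mems b ∪ {m | m = ⟨T, c, n⟩ ∧ n.head ∈ s.vars b}
  finite_vars b := (s.finite_vars b).union ((Set.finite_singleton _).subset fun _ h => h.1)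
  finite_items := s.finite_items
  finite_mems b := (s.finite_mems b).union ((Set.finite_singleton _).subset fun _ h => h.1)
  over_items b i hi := (s.over_items b i hi).mono Set.subset_union_left
  over_mems b m hm := by
    rcases hm with hm | ⟨rfl, hm⟩
    · exact ⟨Or.inl (s.over_mems b m hm).1, Or.inl (s.over_mems b m hm).2⟩
    · exact ⟨Or.inr ⟨rfl, hm⟩, Or.inl hm⟩
  shared b b' m hm hb := by
    rcases hm with hm | ⟨rfl, hm⟩
    · rcases hb with hb | hb
      · exact Or.inl (s.shared b b' m hm hb)
      -- An old assertion cannot have the fresh variable as the head of its bound.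
      · exact absurd (hb.1 ▸ (s.over_mems b' m hm).2) (hc b')
    · rcases hb with hb | hb
      · exact Or.inr ⟨rfl, hb⟩
      · exact Or.inr ⟨rfl, hb.2⟩

theorem le_addWitness (s : State ι) {T : Ty} (c : ℕ) (n : Neutral (.set T))
    (hc : ∀ b, (⟨T, c⟩ : Var) ∉ s.vars b) : s.Le (s.addWitness c n hc) := fun _ =>
  ⟨Set.subset_union_left, subset_rfl, Set.subset_union_left⟩

theorem sat_addWitness {U : Type u} {s : State ι} {T : Ty} {c : ℕ} {n : Neutral (.set T)}
    {hc : ∀ b, (⟨T, c⟩ : Var) ∉ s.vars b} {b : Bool} {ρ : Instance U NatSchema} (h : s.Sat ρ b)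
    (h' : n.head ∈ s.vars b → Mem.Holds ρ ⟨T, c, n⟩) : (s.addWitness c n hc).Sat ρ b :=
  ⟨h.1, fun m hm => hm.elim (h.2 m) fun hm => hm.1 ▸ h' hm.2⟩

theorem exists_fresh (s : State ι) (T : Ty) : ∃ c : ℕ, ∀ b, (⟨T, c⟩ : Var) ∉ s.vars b := by
  have hfin : {c : ℕ | (⟨T, c⟩ : Var) ∈ s.vars true ∪ s.vars false}.Finite :=
    ((s.finite_vars true).union (s.finite_vars false)).preimage fun a _ b _ h => by simpa using h
  obtain ⟨c, hc⟩ := hfin.exists_notMem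
  refine ⟨c, fun b hb => hc ?_⟩
  cases b
  · exact Or.inr hb
  · exact Or.inl hb

end State

/-- Quantify a variable existentially over a bound in the remaining variables. -/
theorem Formula.exists_bind {θ : DeltaZero NatSchema} {C : Set Var} {T : Ty} {c : ℕ}
    (hθ : θ.FV ⊆ insert ⟨T, c⟩ C) (n : Neutral (.set T)) (hn : n.head ∈ C) :
    ∃ θ' : DeltaZero NatSchema, θ'.FV ⊆ C ∧ ∀ (U : Type u) (ρ : Instance U NatSchema),
      θ'.Holds ρ (Env.nil U) ↔ ∃ ρ' : Instance U NatSchema,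
        (∀ x : Var, x ≠ ⟨T, c⟩ → ρ' x.1 x.2 = ρ x.1 x.2) ∧
        ρ' T c ∈ (show Set (T.Obj U) from n.eval ρ) ∧ θ.Holds ρ' (Env.nil U) := by
  classical
  -- The variable to be bound becomes the innermost bound variable; all others stay free.
  let σ : ∀ x : Var, x ∈ insert ⟨T, c⟩ C → Term NatSchema [T] x.1 := fun x _ =>
    if h : x = ⟨T, c⟩ then h ▸ .bvar .here else .fvar x.2
  obtain ⟨θ', hθ', H⟩ := Formula.exists_subst.{0, 0, u} θ (C := C) hθ σ (fun _ x => nomatch x)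
    (fun x hx => by
      by_cases h : x = ⟨T, c⟩
      · subst h
        simp [σ, Term.FV]
      · have := Set.mem_of_mem_insert_of_ne hx h
        simpa [σ, h, Term.FV] using this) (fun _ x => nomatch x)
  refine ⟨.ex n.toTerm θ', Set.union_subset ?_ hθ', fun U ρ => ?_⟩
  · rw [Neutral.FV_toTerm]
    exact Set.singleton_subset_iff.2 hn
  have key : ∀ ρ' : Instance U NatSchema, (∀ x : Var, x ≠ ⟨T, c⟩ → ρ' x.1 x.2 = ρ x.1 x.2) →
      (θ'.Holds ρ (Env.cons (ρ' T c) (Env.nil U)) ↔ θ.Holds ρ' (Env.nil U)) := by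
    intro ρ' hρ'
    refine H U ρ' _ ρ _ (fun x hx => ?_) (fun _ x => nomatch x)
    by_cases h : x = ⟨T, c⟩
    · subst h
      simp [σ, Term.eval, Env.cons]
    · simp [σ, h, Term.eval, hρ' x h]
  simp only [Formula.Holds, Neutral.eval_toTerm]
  constructor
  · rintro ⟨a, ha, h⟩
    obtain ⟨ρ', rfl, hρ'⟩ := exists_update ρ T c a
    exact ⟨ρ', hρ', ha, (key ρ' hρ').1 h⟩
  · rintro ⟨ρ', hρ', ha, h⟩
    exact ⟨_, ha, (key ρ' hρ').2 h⟩

namespace State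

variable {V : Schema.{v}} {ι : ∀ T, V T → ℕ}

/-- If `n` is common, then `c` is common too, and the separator is quantified by `∃ c ∈ n`. The
other side still refutes it: any such element turns a model of that side into one of its extension
by `c ∈ n`. If `n` is private to side `b`, so is `c`, and the separator does not mention `c`. -/
theorem Sep.of_addWitness {s : State ι} {b : Bool} {T : Ty} {c : ℕ} {n : Neutral (.set T)}
    {hc : ∀ b, (⟨T, c⟩ : Var) ∉ s.vars b} {i : Item V} {hi hi'}
    (h : Sep.{u} ((s.addWitness c n hc).addItems b {i} hi hi') b) (hn : n.head ∈ s.vars b)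
    (H : ∀ (U : Type u) (ρ : Instance U NatSchema), s.Sat ρ b →
      ∃ ρ' : Instance U NatSchema, (∀ x : Var, x ≠ ⟨T, c⟩ → ρ' x.1 x.2 = ρ x.1 x.2) ∧
        Mem.Holds ρ' ⟨T, c, n⟩ ∧ i.Holds ι (Name.eval ρ')) : Sep.{u} s b := by
  obtain ⟨θ, hθ, h⟩ := h
  have agree : ∀ {U : Type u} {ρ ρ' : Instance U NatSchema},
      (∀ x : Var, x ≠ ⟨T, c⟩ → ρ' x.1 x.2 = ρ x.1 x.2) → ∀ b, ∀ x ∈ s.vars b,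
      ρ x.1 x.2 = ρ' x.1 x.2 := fun hρ b x hx =>
    (hρ x fun hxc => hc b (hxc ▸ hx)).symm
  have left : ∀ {U : Type u} {ρ : Instance U NatSchema}, s.Sat ρ b →
      ∃ ρ' : Instance U NatSchema, (∀ x : Var, x ≠ ⟨T, c⟩ → ρ' x.1 x.2 = ρ x.1 x.2) ∧
        Mem.Holds ρ' ⟨T, c, n⟩ ∧ θ.Holds ρ' (Env.nil U) := by
    intro U ρ hs
    obtain ⟨ρ', hρ', hm, hi⟩ := H U ρ hs
    exact ⟨ρ', hρ', hm, (h U ρ').1 (sat_addItems_self (sat_addWitness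
      (s.sat_congr (agree hρ' b) hs) fun _ => hm) fun k hk => hk ▸ hi)⟩
  by_cases hn' : n.head ∈ s.vars (!b)
  · obtain ⟨θ', hθ', h'⟩ := Formula.exists_bind.{u} (θ := θ) (C := s.vars b ∩ s.vars (!b))
      (c := c) (fun x hx => by
        rcases hθ hx with ⟨h₁ | h₁, h₂ | h₂⟩
        · exact Or.inr ⟨h₁, h₂⟩
        · exact Or.inl h₂.1
        · exact Or.inl h₁.1
        · exact Or.inl h₁.1) n ⟨hn, hn'⟩
    refine ⟨θ', hθ', fun U ρ => ⟨fun hs => ?_, fun hs hθ => ?_⟩⟩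
    · obtain ⟨ρ', hρ', hm, hh⟩ := left hs
      refine (h' U ρ).2 ⟨ρ', hρ', ?_, hh⟩
      rw [Neutral.eval_congr n (agree hρ' b _ hn)]
      exact hm
    · obtain ⟨ρ', hρ', hm, hh⟩ := (h' U ρ).1 hθ
      rw [Neutral.eval_congr n (agree hρ' b _ hn)] at hm
      exact (h U ρ').2 (sat_addItems_not (sat_addWitness
        (s.sat_congr (agree hρ' (!b)) hs) fun _ => hm)) hh
  · have hθ' : θ.FV ⊆ s.vars b ∩ s.vars (!b) := by
      intro x hx
      rcases hθ hx with ⟨h₁, h₂ | h₂⟩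
      · exact ⟨h₁.resolve_right fun h₁ => hc (!b) (h₁.1 ▸ h₂), h₂⟩
      · exact absurd h₂.2 hn'
    refine ⟨θ, hθ', fun U ρ => ⟨fun hs => ?_, fun hs => ?_⟩⟩
    · obtain ⟨ρ', hρ', -, hh⟩ := left hs
      exact (Formula.holds_congr _ _ fun x hx => agree hρ' b x (hθ' hx).1).2 hh
    · exact (h U ρ).2 (sat_addItems_not (sat_addWitness hs fun hn => absurd hn hn'))

end State

namespace State

variable {V : Schema.{v}} {ι : ∀ T, V T → ℕ}

/-! ### Saturation -/

/-- Side `b` asserts that `a` and `a'` are equal. -/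
def Edge (s : State ι) (b : Bool) (a a' : Neutral .ur) : Prop :=
  ∃ (Γ : List Ty) (t t' : Term V Γ .ur) (e : NameEnv Γ),
    (⟨.eq t t', e⟩ : Item V) ∈ s.items b ∧ a = t.nf ι e ∧ a' = t'.nf ι e

theorem Edge.over {s : State ι} {b : Bool} {a a' : Neutral .ur} (h : s.Edge b a a') :
    a.head ∈ s.vars b ∧ a'.head ∈ s.vars b := by
  obtain ⟨Γ, t, t', e, hi, rfl, rfl⟩ := h
  have ho := s.over_items b _ hi
  exact ⟨t.over_nf ho.2 fun x hx => ho.1 x (Or.inl hx),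
    t'.over_nf ho.2 fun x hx => ho.1 x (Or.inr hx)⟩

theorem Edge.eval {U : Type u} {s : State ι} {b : Bool} {a a' : Neutral .ur}
    (h : s.Edge b a a') {ρ : Instance U NatSchema} (hs : s.Sat ρ b) : a.eval ρ = a'.eval ρ := by
  obtain ⟨Γ, t, t', e, hi, rfl, rfl⟩ := h
  have := hs.1 _ hi
  simp only [Item.Holds, Formula.Holds, Term.eval_nf (Name.respectsPairs_eval ρ)] at this
  exact this

/-- One of the sides asserts an equality between `a` and `a'`. -/
def Adj (s : State ι) (a a' : Neutral .ur) : Prop := ∃ b, s.Edge b a a' ∨ s.Edge b a' a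

theorem Le.adj {s s' : State ι} (h : s.Le s') {a a' : Neutral .ur} (ha : s.Adj a a') :
    s'.Adj a a' := by
  obtain ⟨b, ha⟩ := ha
  refine ⟨b, ha.imp ?_ ?_⟩ <;> exact fun ⟨Γ, t, t', e, hi, h₁⟩ => ⟨Γ, t, t', e, (h b).2.1 hi, h₁⟩

/-- An equality that follows from both sides together follows from one side together with a
consequence of the other side in the common variables. -/
theorem exists_chain_interpolant (s : State ι) (b : Bool) {a a' : Neutral .ur}
    (ha : a.head ∈ s.vars b) (h : Relation.ReflTransGen s.Adj a a') :
    ∃ (p : DeltaZero NatSchema) (d : Neutral .ur), p.FV ⊆ s.vars b ∩ s.vars (!b) ∧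
      d.head ∈ s.vars b ∧
      (d = a' ∨ d.head ∈ s.vars (!b) ∧ a'.head ∈ s.vars (!b) ∧
        ∀ (U : Type u) (ρ : Instance U NatSchema), s.Sat ρ (!b) → d.eval ρ = a'.eval ρ) ∧
      ∀ (U : Type u) (ρ : Instance U NatSchema), (s.Sat ρ (!b) → p.Holds ρ (Env.nil U)) ∧
        (s.Sat ρ b → p.Holds ρ (Env.nil U) → a.eval ρ = d.eval ρ) := by
  -- Here `d` is the point where the chain last left side `b`, or its current end if it has not
  -- left. The formula `p` collects the completed detours through the other side; a detour still
  -- open is recorded by the last disjunct for `d`.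
  induction h with
  | refl => exact ⟨.top, a, Set.empty_subset _, ha, Or.inl rfl, fun U ρ =>
      ⟨fun _ => trivial, fun _ _ => rfl⟩⟩
  | @tail a₁ a₂ _ h ih =>
    obtain ⟨p, d, hp, hd, hda, H⟩ := ih
    obtain ⟨b', hb'⟩ := h
    have hover : a₁.head ∈ s.vars b' ∧ a₂.head ∈ s.vars b' :=
      hb'.elim (fun h => h.over) fun h => h.over.symm
    have heval : ∀ (U : Type u) (ρ : Instance U NatSchema), s.Sat ρ b' →
        a₁.eval ρ = a₂.eval ρ := fun U ρ hs =>
      hb'.elim (fun h => h.eval hs) fun h => (h.eval hs).symm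
    rcases Bool.eq_or_eq_not b' b with rfl | rfl
    · rcases hda with rfl | ⟨hd', ha₁, hda⟩
      · exact ⟨p, a₂, hp, hover.2, Or.inl rfl, fun U ρ =>
          ⟨(H U ρ).1, fun hs hpρ => ((H U ρ).2 hs hpρ).trans (heval U ρ hs)⟩⟩
      -- The chain returns to side `b`, so `a₁` occurs on both sides, and the detour closes as the
      -- new conjunct `d = a₁`.
      · refine ⟨.and p (.eq d.toTerm a₁.toTerm), a₂, ?_, hover.2, Or.inl rfl, fun U ρ =>
          ⟨fun hs => ⟨(H U ρ).1 hs, ?_⟩, fun hs hpρ => ?_⟩⟩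
        · simp only [Formula.FV, Neutral.FV_toTerm]
          refine Set.union_subset hp (Set.union_subset ?_ ?_) <;> rw [Set.singleton_subset_iff]
          · exact ⟨hd, hd'⟩
          · exact ⟨hover.1, ha₁⟩
        · simp only [Formula.Holds, Neutral.eval_toTerm]
          exact hda U ρ hs
        · have h₁ := hpρ.2
          simp only [Formula.Holds, Neutral.eval_toTerm] at h₁
          exact (((H U ρ).2 hs hpρ.1).trans h₁).trans (heval U ρ hs)
    -- An edge of the other side opens a detour at `d` or prolongs the open one.
    · refine ⟨p, d, hp, hd, Or.inr ?_, H⟩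
      rcases hda with rfl | ⟨hd', -, hda⟩
      · exact ⟨hover.1, hover.2, heval⟩
      · exact ⟨hd', hover.2, fun U ρ hs => (hda U ρ hs).trans (heval U ρ hs)⟩

/-- Side `b` refutes `p`, or `p ∧ d = a'` if the chain ends in an open detour, while the other side
proves it; its negation separates. -/
theorem Sep.of_chain {s : State ι} {b : Bool} {a a' : Neutral .ur} (ha : a.head ∈ s.vars b)
    (ha' : a'.head ∈ s.vars b) (h : Relation.ReflTransGen s.Adj a a')
    (hne : ∀ (U : Type u) (ρ : Instance U NatSchema), s.Sat ρ b → a.eval ρ ≠ a'.eval ρ) :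
    Sep.{u} s b := by
  obtain ⟨p, d, hp, hd, hda, H⟩ := exists_chain_interpolant.{u} s b ha h
  rcases hda with rfl | ⟨hd', ha'', hda⟩
  · refine ⟨p.neg, p.FV_neg.trans_subset hp, fun U ρ => ?_⟩
    rw [Formula.holds_neg, not_not]
    exact ⟨fun hs hpρ => hne U ρ hs ((H U ρ).2 hs hpρ), (H U ρ).1⟩
  · refine ⟨.or p.neg (.neq d.toTerm a'.toTerm), ?_, fun U ρ => ?_⟩
    · simp only [Formula.FV, Neutral.FV_toTerm, Formula.FV_neg]
      refine Set.union_subset hp (Set.union_subset ?_ ?_) <;> rw [Set.singleton_subset_iff]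
      · exact ⟨hd, hd'⟩
      · exact ⟨ha', ha''⟩
    · simp only [Formula.Holds, Formula.holds_neg, Neutral.eval_toTerm]
      refine ⟨fun hs => ?_, fun hs => ?_⟩
      · by_cases hpρ : p.Holds ρ (Env.nil U)
        · exact Or.inr fun hd => hne U ρ hs (((H U ρ).2 hs hpρ).trans hd)
        · exact Or.inl hpρ
      · exact not_or.2 ⟨not_not.2 ((H U ρ).1 hs), not_not.2 (hda U ρ hs)⟩

theorem Sep.of_neq {s : State ι} {b : Bool} {Γ : List Ty} {t t' : Term V Γ .ur} {e : NameEnv Γ}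
    (hi : (⟨.neq t t', e⟩ : Item V) ∈ s.items b)
    (h : Relation.ReflTransGen s.Adj (t.nf ι e) (t'.nf ι e)) : Sep.{u} s b := by
  have ho := s.over_items b _ hi
  refine Sep.of_chain (t.over_nf ho.2 fun x hx => ho.1 x (Or.inl hx))
    (t'.over_nf ho.2 fun x hx => ho.1 x (Or.inr hx)) h fun U ρ hs => ?_
  have := hs.1 _ hi
  simp only [Item.Holds, Formula.Holds, Term.eval_nf (Name.respectsPairs_eval ρ)] at this
  exact this

theorem Sep.of_bot {s : State ι} {b : Bool} {Γ : List Ty} {e : NameEnv Γ}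
    (hi : (⟨.bot, e⟩ : Item V) ∈ s.items b) : Sep.{u} s b :=
  ⟨.bot, Set.empty_subset _, fun _ _ => ⟨fun hs => hs.1 _ hi, fun _ h => h⟩⟩

/-- The state `s` reduces an instantiated formula of side `b`, where universal quantifiers are
instantiated by the elements known in `s₀`. -/
def Reduces (s₀ s : State ι) (b : Bool) : Item V → Prop
  | ⟨.eq _ _, _⟩ => True
  | ⟨.neq _ _, _⟩ => True
  | ⟨.top, _⟩ => True
  | ⟨.bot, _⟩ => True
  | ⟨.or φ ψ, e⟩ => (⟨φ, e⟩ : Item V) ∈ s.items b ∨ (⟨ψ, e⟩ : Item V) ∈ s.items b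
  | ⟨.and φ ψ, e⟩ => (⟨φ, e⟩ : Item V) ∈ s.items b ∧ (⟨ψ, e⟩ : Item V) ∈ s.items b
  | ⟨.all (T := T) t φ, e⟩ => ∀ c : ℕ, (⟨T, c, t.nf ι e⟩ : Mem) ∈ s₀.mems b →
      (⟨φ, NameEnv.cons (Name.ofVar T c) e⟩ : Item V) ∈ s.items b
  | ⟨.ex (T := T) t φ, e⟩ => ∃ c : ℕ, (⟨T, c, t.nf ι e⟩ : Mem) ∈ s.mems b ∧
      (⟨φ, NameEnv.cons (Name.ofVar T c) e⟩ : Item V) ∈ s.items b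

/-- Universal formulas refer only to the elements known in the fixed state `s₀`. With the growing
state in its place, new elements would destroy monotonicity. -/
theorem Reduces.mono {s₀ s s' : State ι} (h : s.Le s') {b : Bool} {i : Item V}
    (hi : Reduces s₀ s b i) : Reduces s₀ s' b i := by
  obtain ⟨φ, e⟩ := i
  cases φ with
  | eq | neq | top | bot => trivial
  | or φ ψ => exact hi.imp (fun h' => (h b).2.1 h') fun h' => (h b).2.1 h'
  | and φ ψ => exact hi.imp (fun h' => (h b).2.1 h') fun h' => (h b).2.1 h'
  | all t φ => exact fun c hc => (h b).2.1 (hi c hc)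
  | ex t φ =>
    obtain ⟨c, h₁, h₂⟩ := hi
    exact ⟨c, (h b).2.2 h₁, (h b).2.1 h₂⟩

theorem over_cons {A : Set Var} {Γ : List Ty} {T : Ty} {e : NameEnv Γ}
    (he : ∀ T x, (e T x).Over A) {c : ℕ} (hc : (⟨T, c⟩ : Var) ∈ A) (S : Ty) (x : BVar (T :: Γ) S) :
    (NameEnv.cons (Name.ofVar T c) e S x).Over A := by
  cases x with
  | here => exact Neutral.over_reflect _ hc
  | there x => exact he _ x

/-- A separator of the extended state (for a disjunction, separators of both possible extensions)
would give one of `s`. -/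
theorem exists_reduces {s₀ s : State ι} (h₀ : s₀.Le s) (hs : ¬ Sep.{u} s true) {b : Bool}
    {i : Item V} (hi : i ∈ s.items b) :
    ∃ s' : State ι, s.Le s' ∧ ¬ Sep.{u} s' true ∧ Reduces s₀ s' b i := by
  have hs' : ¬ Sep.{u} s b := fun h => hs (h.side true)
  have ho := s.over_items b i hi
  obtain ⟨φ, e⟩ := i
  cases φ with
  | eq | neq | top | bot => exact ⟨s, Le.rfl, hs, trivial⟩
  | or φ ψ =>
    have hoφ : ∀ j ∈ ({⟨φ, e⟩} : Set (Item V)), j.Over ι (s.vars b) := by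
      rintro j rfl
      exact ⟨fun x hx => ho.1 x (Or.inl hx), ho.2⟩
    have hoψ : ∀ j ∈ ({⟨ψ, e⟩} : Set (Item V)), j.Over ι (s.vars b) := by
      rintro j rfl
      exact ⟨fun x hx => ho.1 x (Or.inr hx), ho.2⟩
    -- If adding `φ` makes the state separable, adding `ψ` cannot, since the two separators would
    -- combine.
    by_cases h₁ : Sep.{u} (s.addItems b {⟨φ, e⟩} (Set.finite_singleton _) hoφ) b
    · refine ⟨s.addItems b {⟨ψ, e⟩} (Set.finite_singleton _) hoψ, le_addItems _ _ _ _ _, fun h₂ => ?_,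
        Or.inr (Or.inr ⟨rfl, rfl⟩)⟩
      exact hs' (h₁.of_addItems_or (h₂.side b) fun U ρ hρ => hρ.1 _ hi)
    · exact ⟨_, le_addItems _ _ _ _ _, fun h₂ => h₁ (h₂.side b), Or.inl (Or.inr ⟨rfl, rfl⟩)⟩
  | and φ ψ =>
    refine ⟨s.addItems b {⟨φ, e⟩, ⟨ψ, e⟩} (Set.toFinite _) ?_, le_addItems _ _ _ _ _, fun h => ?_,
      Or.inr ⟨rfl, Or.inl rfl⟩, Or.inr ⟨rfl, Or.inr rfl⟩⟩
    · rintro j (rfl | rfl)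
      · exact ⟨fun x hx => ho.1 x (Or.inl hx), ho.2⟩
      · exact ⟨fun x hx => ho.1 x (Or.inr hx), ho.2⟩
    · refine hs' ((h.side b).of_addItems fun U ρ hρ => ?_)
      rintro j (rfl | rfl)
      · exact (hρ.1 _ hi).1
      · exact (hρ.1 _ hi).2
  | @all _ T t φ =>
    -- All elements known in `s` are used; by `h₀` they include those known in `s₀`.
    let J : Set (Item V) := (fun c : ℕ => (⟨φ, NameEnv.cons (Name.ofVar T c) e⟩ : Item V)) ''
      {c | (⟨T, c, t.nf ι e⟩ : Mem) ∈ s.mems b}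
    have hJ : J.Finite := ((s.finite_mems b).preimage fun c _ c' _ h => congrArg Mem.elt h).image _
    refine ⟨s.addItems b J hJ ?_, le_addItems _ _ _ _ _, fun h => ?_, fun c hc =>
      Or.inr ⟨rfl, c, (h₀ b).2.2 hc, rfl⟩⟩
    · rintro j ⟨c, hc, rfl⟩
      exact ⟨fun x hx => ho.1 x (Or.inr hx), over_cons ho.2 (s.over_mems b _ hc).1⟩
    · refine hs' ((h.side b).of_addItems fun U ρ hρ => ?_)
      rintro j ⟨c, hc, rfl⟩
      have hall := hρ.1 _ hi
      have hmem := hρ.2 _ hc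
      simp only [Item.Holds, Formula.Holds, Term.eval_nf (Name.respectsPairs_eval ρ)] at hall ⊢
      rw [NameEnv.map_cons]
      refine hall _ ?_
      rw [Name.ofVar, Neutral.eval_reflect]
      exact hmem
  | @ex _ T t φ =>
    obtain ⟨c, hc⟩ := s.exists_fresh T
    have hn : Neutral.head (t.nf ι e) ∈ s.vars b := t.over_nf ho.2 fun x hx => ho.1 x (Or.inl hx)
    refine ⟨(s.addWitness c (t.nf ι e) hc).addItems b
      {⟨φ, NameEnv.cons (Name.ofVar T c) e⟩} (Set.finite_singleton _) ?_,
      (le_addWitness _ _ _ _).trans (le_addItems _ _ _ _ _), fun h => ?_, c, Or.inr ⟨rfl, hn⟩,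
      Or.inr ⟨rfl, rfl⟩⟩
    · rintro j rfl
      exact ⟨fun x hx => Or.inl (ho.1 x (Or.inr hx)),
        over_cons (fun S x => (ho.2 S x).mono Set.subset_union_left) (Or.inr ⟨rfl, hn⟩)⟩
    · refine hs' ((h.side b).of_addWitness hn fun U ρ hρ => ?_)
      have hex := hρ.1 _ hi
      simp only [Item.Holds, Formula.Holds, Term.eval_nf (Name.respectsPairs_eval ρ)] at hex
      obtain ⟨a, ha, hex⟩ := hex
      obtain ⟨ρ', rfl, hρ'⟩ := exists_update ρ T c a
      have agree : ∀ x ∈ s.vars b, ρ x.1 x.2 = ρ' x.1 x.2 := fun x hx =>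
        (hρ' x fun hxc => hc b (hxc ▸ hx)).symm
      refine ⟨ρ', hρ', ?_, ?_⟩
      · change ρ' T c ∈ (show Set (T.Obj U) from Neutral.eval ρ' (t.nf ι e))
        rw [← Neutral.eval_congr (t.nf ι e) (agree _ hn)]
        exact ha
      · have henv : (fun T x => (e T x).eval ρ) = fun T x => (e T x).eval ρ' := by
          funext S x
          exact Name.eval_congr agree (ho.2 S x)
        simp only [Item.Holds]
        rw [NameEnv.map_cons, ← henv, Name.ofVar, Neutral.eval_reflect]
        exact (Formula.holds_congr (I := instanceOf ι (Name.eval ρ))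
          (J := instanceOf ι (Name.eval ρ')) _ _ fun x hx => Name.eval_congr agree
            (Neutral.over_reflect _ (ho.1 x (Or.inr hx)))).1 hex

/-- A state has finitely many formulas; they are treated one at a time, and earlier reductions
persist by `Reduces.mono`. -/
theorem exists_reduces_all {s : State ι} (hs : ¬ Sep.{u} s true) :
    ∃ s' : State ι, s.Le s' ∧ ¬ Sep.{u} s' true ∧ ∀ b, ∀ i ∈ s.items b, Reduces s s' b i := by
  have main : ∀ J : Set (Bool × Item V), J.Finite → (∀ p ∈ J, p.2 ∈ s.items p.1) →
      ∃ s' : State ι, s.Le s' ∧ ¬ Sep.{u} s' true ∧ ∀ p ∈ J, Reduces s s' p.1 p.2 := by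
    intro J hJ
    induction J, hJ using Set.Finite.induction_on with
    | empty => exact fun _ => ⟨s, Le.rfl, hs, fun _ h => h.elim⟩
    | @insert p J _ _ ih =>
      intro h
      obtain ⟨s₁, h₁, hs₁, hJ₁⟩ := ih fun q hq => h q (Or.inr hq)
      obtain ⟨s₂, h₂, hs₂, hp⟩ := exists_reduces.{u} h₁ hs₁ ((h₁ _).2.1 (h p (Or.inl rfl)))
      refine ⟨s₂, h₁.trans h₂, hs₂, ?_⟩
      rintro q (rfl | hq)
      · exact hp
      · exact (hJ₁ q hq).mono h₂
  obtain ⟨s', h, hs', hr⟩ := main {p | p.2 ∈ s.items p.1}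
    ((Set.finite_iUnion fun b => (s.finite_items b).image (Prod.mk b)).subset fun p hp =>
      Set.mem_iUnion.2 ⟨p.1, p.2, hp, rfl⟩) fun _ h => h
  exact ⟨s', h, hs', fun b i hi => hr (b, i) hi⟩

/-- An inseparable state extends to a saturated sequence of inseparable states. -/
theorem exists_saturated {s : State ι} (hs : ¬ Sep.{u} s true) :
    ∃ S : ℕ → State ι, S 0 = s ∧ (∀ k l, k ≤ l → (S k).Le (S l)) ∧
      (∀ k b, ¬ Sep.{u} (S k) b) ∧ ∀ k b, ∀ i ∈ (S k).items b, Reduces (S k) (S (k + 1)) b i := by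
  choose next h₁ h₂ h₃ using fun s : {s : State ι // ¬ Sep.{u} s true} => exists_reduces_all s.2
  let S : ℕ → {s : State ι // ¬ Sep.{u} s true} := fun k =>
    Nat.rec ⟨s, hs⟩ (fun _ s => ⟨next s, h₂ s⟩) k
  refine ⟨fun k => (S k).1, rfl, fun k l hkl => ?_, fun k b h => (S k).2 (h.side true),
    fun k => h₃ (S k)⟩
  induction l, hkl using Nat.le_induction with
  | base => exact Le.rfl
  | succ l _ ih => exact ih.trans (h₁ (S l))

/-! ### The model of a saturated sequence -/

/-- Provable equality of names of Ur-elements in the limit of a sequence of states. -/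
def urSetoid (S : ℕ → State ι) : Setoid (Neutral .ur) where
  r := Relation.ReflTransGen fun a a' => ∃ k, (S k).Adj a a'
  iseqv :=
    { refl := fun _ => .refl
      symm := fun h => by
        have : Std.Symm fun a a' => ∃ k, (S k).Adj a a' := ⟨fun a a' ⟨k, b, h⟩ => ⟨k, b, h.symm⟩⟩
        exact symm h
      trans := fun h h' => h.trans h' }

/-- A chain uses finitely many edges, all of which are present at some stage. -/
theorem exists_of_urSetoid {S : ℕ → State ι} (hS : ∀ k l, k ≤ l → (S k).Le (S l))
    {a a' : Neutral .ur} (h : urSetoid S a a') :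
    ∃ k, Relation.ReflTransGen (S k).Adj a a' := by
  change Relation.ReflTransGen _ a a' at h
  induction h with
  | refl => exact ⟨0, .refl⟩
  | tail _ h ih =>
    obtain ⟨k, hk⟩ := ih
    obtain ⟨l, hl⟩ := h
    exact ⟨max k l, .tail
      (Relation.ReflTransGen.mono (fun _ _ => (hS k _ (le_max_left k l)).adj) _ _ hk)
      ((hS l _ (le_max_right k l)).adj hl)⟩

/-- The object named by a name in the limit of a sequence of states. -/
def value (S : ℕ → State ι) : (T : Ty) → Name T → T.Obj (Quotient (urSetoid S))
  | .ur => fun n => Quotient.mk (urSetoid S) n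
  | .unit => fun _ => PUnit.unit
  | .prod A B => fun n => (value S A n.1, value S B n.2)
  | .set T => fun n => {a | ∃ (k : ℕ) (b : Bool) (c : ℕ),
      (⟨T, c, n⟩ : Mem) ∈ (S k).mems b ∧ value S T (Name.ofVar T c) = a}

theorem respectsPairs_value (S : ℕ → State ι) : RespectsPairs (value S) := fun _ _ _ _ => rfl

/-- Every instantiated formula of a saturated sequence holds in its model. -/
theorem holds_value {S : ℕ → State ι} (hS : ∀ k l, k ≤ l → (S k).Le (S l))
    (hsep : ∀ k b, ¬ Sep.{u} (S k) b)
    (hred : ∀ k b, ∀ i ∈ (S k).items b, Reduces (S k) (S (k + 1)) b i) {b : Bool} {Γ : List Ty}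
    (φ : Formula V Γ) (e : NameEnv Γ) (k : ℕ) (hi : (⟨φ, e⟩ : Item V) ∈ (S k).items b) :
    Item.Holds ι (value S) ⟨φ, e⟩ := by
  induction φ generalizing k with
  | eq t t' =>
    simp only [Item.Holds, Formula.Holds, Term.eval_nf (respectsPairs_value S)]
    exact Quotient.sound (Relation.ReflTransGen.single
      ⟨k, b, Or.inl ⟨_, t, t', e, hi, rfl, rfl⟩⟩)
  | neq t t' =>
    simp only [Item.Holds, Formula.Holds, Term.eval_nf (respectsPairs_value S)]
    intro h
    obtain ⟨l, hl⟩ := exists_of_urSetoid hS (Quotient.exact h)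
    exact hsep (max k l) b (Sep.of_neq (((hS k _ (le_max_left k l)) b).2.1 hi)
      (Relation.ReflTransGen.mono (fun _ _ => (hS l _ (le_max_right k l)).adj) _ _ hl))
  | top => trivial
  | bot => exact (hsep k b (Sep.of_bot hi)).elim
  | or φ ψ ihφ ihψ => exact (hred k b _ hi).imp (ihφ e (k + 1)) (ihψ e (k + 1))
  | and φ ψ ihφ ihψ => exact (hred k b _ hi).imp (ihφ e (k + 1)) (ihψ e (k + 1))
  | all t φ ih =>
    simp only [Item.Holds, Formula.Holds, Term.eval_nf (respectsPairs_value S)]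
    rintro a ⟨l, b', c, hc, rfl⟩
    -- At stage `max k l` both the formula and the membership are present. The bound is a name of
    -- side `b`, so `shared` moves the membership there even if side `b'` asserted it, and the next
    -- stage contains the instance.
    have hi' := ((hS k _ (le_max_left k l)) b).2.1 hi
    have hc' := ((hS l _ (le_max_right k l)) b').2.2 hc
    have ho := (S (max k l)).over_items b _ hi'
    have := ih _ _ (hred _ b _ hi' c ((S (max k l)).shared b b' _ hc'
      (t.over_nf ho.2 fun x hx => ho.1 x (Or.inl hx))))
    simp only [Item.Holds] at this
    rwa [NameEnv.map_cons] at this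
  | ex t φ ih =>
    simp only [Item.Holds, Formula.Holds, Term.eval_nf (respectsPairs_value S)]
    obtain ⟨c, hc, hi'⟩ := hred k b _ hi
    refine ⟨_, ⟨k + 1, b, c, hc, rfl⟩, ?_⟩
    have := ih _ _ hi'
    simp only [Item.Holds] at this
    rwa [NameEnv.map_cons] at this

/-- The initial state of a pair of formulas. -/
def ofPair (ι : ∀ T, V T → ℕ) (φ : Bool → DeltaZero V) : State ι where
  vars b := (fun x : Σ T, V T => (⟨x.1, ι x.1 x.2⟩ : Var)) '' (φ b).FV
  items b := {⟨φ b, fun _ x => nomatch x⟩}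
  mems _ := ∅
  finite_vars b := (φ b).FV_finite.image _
  finite_items _ := Set.finite_singleton _
  finite_mems _ := Set.finite_empty
  over_items b i hi := by
    obtain rfl := hi
    exact ⟨fun x hx => ⟨x, hx, rfl⟩, fun _ x => nomatch x⟩
  over_mems _ _ h := h.elim
  shared _ _ _ h := h.elim

/-- Jointly unsatisfiable formulas are separable. -/
theorem sep_ofPair (ι : ∀ T, V T → ℕ) (φ : Bool → DeltaZero V)
    (h : ∀ (U : Type u) (I : Instance U V), ¬ ∀ b, (φ b).Holds I (Env.nil U)) :
    Sep.{u} (ofPair ι φ) true := by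
  by_contra hs
  obtain ⟨S, hS₀, hS, hsep, hred⟩ := exists_saturated hs
  -- The quotient lives in `Type`, whereas the hypothesis speaks of Ur-elements in `Type u`.
  refine h (ULift.{u} (Quotient (urSetoid S)))
    (fun T x => T.map ULift.up (instanceOf ι (value S) T x)) fun b => ?_
  rw [Formula.holds_map_nil ULift.up_injective]
  have := holds_value hS hsep hred (b := b) (φ b) (fun _ x => nomatch x) 0 (by rw [hS₀]; rfl)
  simp only [Item.Holds] at this
  rwa [Env.eq_nil fun T x => value S T _] at this

end State

/-! ### Numbering the variables, and the interpolation theorem -/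

/-- Finitely many variables can be numbered, and any values for them be realised. -/
theorem exists_numbering {V : Schema.{v}} {F : Set (Σ T, V T)} (hF : F.Finite) :
    ∃ ι : ∀ T, V T → ℕ, F.InjOn (fun x => (⟨x.1, ι x.1 x.2⟩ : Var)) ∧
      ∀ (U : Type u) [Nonempty U] (I : Instance U V), ∃ ρ : Instance U NatSchema,
        ∀ x ∈ F, ρ x.1 (ι x.1 x.2) = I x.1 x.2 := by
  classical
  obtain ⟨f, hf⟩ := Set.countable_iff_exists_injOn.1 hF.countable
  have hinj : F.InjOn (fun x => (⟨x.1, f x⟩ : Var)) := fun x hx y hy h => hf hx hy (by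
    simp only [Sigma.mk.injEq] at h
    exact eq_of_heq h.2)
  refine ⟨fun T x => f ⟨T, x⟩, hinj, fun U _ I => ?_⟩
  have hne := Ty.nonempty_obj U
  -- Numbers that no variable in `F` uses get an arbitrary object; this is where `U` must be
  -- nonempty.
  refine ⟨fun T k => if h : ∃ x : V T, ⟨T, x⟩ ∈ F ∧ f ⟨T, x⟩ = k then I T h.choose
    else (hne T).some, ?_⟩
  rintro ⟨T, x⟩ hx
  have h : ∃ y : V T, ⟨T, y⟩ ∈ F ∧ f ⟨T, y⟩ = f ⟨T, x⟩ := ⟨x, hx, rfl⟩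
  have hy : h.choose = x := by
    have := hf h.choose_spec.1 hx h.choose_spec.2
    simpa using this
  simp only [dif_pos h, hy]

end NestedRel

theorem mainTheorem8 (V : NestedRel.Schema.{v}) (φ ψ : NestedRel.DeltaZero V)
    (h : NestedRel.Entails.{u, v} φ ψ) :
    ∃ θ : NestedRel.DeltaZero V,
      θ.FV ⊆ φ.FV ∩ ψ.FV ∧ NestedRel.Entails.{u, v} φ θ ∧ NestedRel.Entails.{u, v} θ ψ := by
  open NestedRel in
  obtain ⟨ι, hinj, hρ⟩ := exists_numbering.{u, v} (φ.FV_finite.union ψ.FV_finite)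
  let χ : Bool → DeltaZero V := fun b => if b then φ else ψ.neg
  obtain ⟨θ, hθ, hsep⟩ := State.sep_ofPair.{u, v} ι χ fun U I hI =>
    (ψ.holds_neg I _).1 (hI false) (h U I (hI true))
  have hC : ∀ y ∈ θ.FV, ∃ x ∈ φ.FV ∩ ψ.FV, (⟨x.1, ι x.1 x.2⟩ : Var) = y := by
    intro y hy
    obtain ⟨⟨x, hx, rfl⟩, x', hx', hxx'⟩ := hθ hy
    have hx' : x' ∈ ψ.FV := ψ.FV_neg ▸ hx'
    -- Injectivity on the variables of both formulas: a number common to both sides comes from a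
    -- common variable, so the separator can be renamed back.
    obtain rfl := hinj (Or.inr hx') (Or.inl hx) hxx'
    exact ⟨x', ⟨hx, hx'⟩, rfl⟩
  choose g hg hgy using hC
  have hty : ∀ y hy, (g y hy).1 = y.1 := fun y hy => congrArg Sigma.fst (hgy y hy)
  obtain ⟨θ', hθ', H⟩ := Formula.exists_subst.{0, v, u} θ (C := φ.FV ∩ ψ.FV) subset_rfl
    (Γ' := []) (fun y hy => hty y hy ▸ .fvar (g y hy).2) (fun _ x => nomatch x)
    (fun y hy => by
      have h₁ := hg y hy
      have h₂ := hgy y hy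
      -- The substituted term is a cast along `hty`. Once `g y hy` is generalised, `h₂` can
      -- eliminate `y` and the cast becomes trivial.
      generalize_proofs p
      revert p
      generalize g y hy = x at h₁ h₂
      subst h₂
      intro p
      simpa [Term.FV] using h₁) (fun _ x => nomatch x)
  have key : ∀ (U : Type u) (I : Instance U V), ∃ ρ : Instance (Option U) NatSchema,
      (θ'.Holds I (Env.nil U) ↔ θ.Holds ρ (Env.nil _)) ∧
      ∀ b, (χ b).Holds I (Env.nil U) ↔ (State.ofPair ι χ).Sat ρ b := by
    intro U I
    -- If `U` is empty, numbered variables of type `Ur` have no value. An extra Ur-element cures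
    -- this, and truth is invariant under the injection `some`.
    let I' : Instance (Option U) V := fun T x => T.map some (I T x)
    obtain ⟨ρ, hρ⟩ := hρ (Option U) I'
    refine ⟨ρ, ?_, fun b => ?_⟩
    · rw [← Formula.holds_map_nil (Option.some_injective U)]
      refine H (Option U) ρ _ I' _ (fun y hy => ?_) (fun _ x => nomatch x)
      have h₁ := hg y hy
      have h₂ := hgy y hy
      generalize_proofs p
      revert p
      generalize g y hy = x at h₁ h₂
      subst h₂
      intro p
      exact (hρ x (Or.inl h₁.1)).symm
    · rw [← Formula.holds_map_nil (Option.some_injective U)]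
      have : (χ b).Holds I' (Env.nil _) ↔
          Item.Holds ι (Name.eval ρ) (⟨χ b, fun _ x => nomatch x⟩ : Item V) := by
        simp only [Item.Holds]
        rw [Env.eq_nil fun T x => Name.eval ρ T _]
        refine Formula.holds_congr _ _ fun x hx => ?_
        rw [instanceOf, Name.ofVar, Neutral.eval_reflect]
        refine (hρ x ?_).symm
        cases b
        · exact Or.inr (ψ.FV_neg ▸ hx)
        · exact Or.inl hx
      refine this.trans ⟨fun hh => ⟨?_, fun _ h => h.elim⟩, fun hh => hh.1 _ rfl⟩
      rintro i rfl
      exact hh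
  refine ⟨θ', hθ', fun U I hφ => ?_, fun U I hθ => ?_⟩
  · obtain ⟨ρ, h₁, h₂⟩ := key U I
    exact h₁.2 ((hsep _ ρ).1 ((h₂ true).1 hφ))
  · obtain ⟨ρ, h₁, h₂⟩ := key U I
    by_contra hψ
    exact (hsep _ ρ).2 ((h₂ false).1 ((ψ.holds_neg I _).2 hψ)) (h₁.1 hθ)
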